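/- Let $T$ be a tree with countable vertex set, also denoted $T$, and root $o$. Let $P=(p(x,y))_{x,y\in T}$ be a Markov operator ($p(x,y)\ge 0$, $\sum_y p(x,y)=1$) whose graph is $T$, i.e. $p(x,y)>0$ if and only if $x$ and $y$ are adjacent, and suppose that the random walk $(T,P)$ is irreducible and transient. Let $F(x,y)$ be the probability that the walk started at $x$ ever visits $y$ (so $F(x,x)=1$), and let $k_o(x,y)=F(x,y)/F(o,y)$ be the Martin kernel. Let $\widehat T$ be the Martin compactification, that is, the smallest compactification of the discrete set $T$ to which every function $k_o(x,\cdot)$, $x\in T$, extends continuously (the extension is again denoted $k_o(x,\cdot)$), and let $\partial T=\widehat T\setminus T$ be the Martin boundary. A function $h:T\to\mathbb R$ is harmonic if $\sum_y p(x,y)|h(y)|<\infty$ and $\sum_y p(x,y)h(y)=h(x)$ for every $x\in T$. For a finite signed measure $\mu$ on $T$ (with the $\sigma$-algebra of all subsets), $h\in L^1(|\mu|)$ and $x\in T$, put $$L(h,\mu)(x)=\int_T h\,d\mu-\mu(T)\,h(x).$$ The measure $\mu$ has the strong mean value property (MVP) with respect to $o$ if $L(h,\mu)(o)=0$ for every harmonic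 $h\in L^1(|\mu|)$, and the weak MVP with respect to $o$ if $L(h,\mu)(o)=0$ for every bounded harmonic $h$. Let $\mu$ be a signed measure on $T$ with finite support. Then: 1. If $\mu$ has the strong MVP with respect to $o$, then $\mu$ has the weak MVP with respect to $o$. 2. If $T$ is locally finite, then $\mu$ has the strong MVP with respect to $o$ if and only if $L(k_o(\cdot,\xi),\mu)(o)=0$ for every $\xi\in\partial T$. 3. Without assuming local finiteness, $\mu$ has the strong MVP with respect to $o$ if and only if $L(k_o(\cdot,\xi),\mu)(o)=0$ for every $\xi\in\partial T$ for which the function $k_o(\cdot,\xi)$ is harmonic. -/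

import Mathlib

open MeasureTheory

noncomputable section

namespace MVPTree

variable {V : Type*}

/-- `p` is the transition function of a Markov operator on `V`: nonnegative entries, and every row
sums to `1`. -/
structure IsMarkov (p : V → V → ℝ) : Prop where
  nonneg : ∀ x y, 0 ≤ p x y
  row_sum : ∀ x, HasSum (p x) 1

open Classical in
/-- The `n`-step transition probabilities `p⁽ⁿ⁾(x, y) = Pr_x(Z_n = y)`. -/
def stepProb (p : V → V → ℝ) : ℕ → V → V → ℝ
  | 0, x, y => if x = y then 1 else 0
  | n + 1, x, y => ∑' z, p x z * stepProb p n z y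

/-- Irreducibility: every state can be reached from every state. -/
def IsIrreducible (p : V → V → ℝ) : Prop :=
  ∀ x y, ∃ n, 0 < stepProb p n x y

/-- Transience: the Green function `G(x, y) = ∑ₙ p⁽ⁿ⁾(x, y)` is finite. -/
def IsTransient (p : V → V → ℝ) : Prop :=
  ∀ x y, Summable fun n => stepProb p n x y

/-- The graph generated by the random walk (edges `(x, y)` with `p(x, y) > 0`) is `T`. -/
def IsAdapted (T : SimpleGraph V) (p : V → V → ℝ) : Prop :=
  ∀ x y, 0 < p x y ↔ T.Adj x y

open Classical in
/-- The first hitting probabilities `f⁽ⁿ⁾(x, y) = Pr_x(Z_n = y, Z_i ≠ y for 0 ≤ i < n)`. -/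
def firstHitProb (p : V → V → ℝ) : ℕ → V → V → ℝ
  | 0, x, y => if x = y then 1 else 0
  | n + 1, x, y => if x = y then 0 else ∑' z, p x z * firstHitProb p n z y

/-- `F(x, y) = ∑ₙ f⁽ⁿ⁾(x, y)`, the probability that the walk started at `x` ever visits `y`. -/
def hitProb (p : V → V → ℝ) (x y : V) : ℝ :=
  ∑' n, firstHitProb p n x y

/-- The Martin kernel `k_o(x, y) = F(x, y) / F(o, y)` on `V × V`. -/
def martinKernel (p : V → V → ℝ) (o x y : V) : ℝ :=
  hitProb p x y / hitProb p o y

open Classical in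
/-- The evaluation map of the family of functions `k_o(x, ·)` and `𝟙_{x}`, for `x` in `V`. The second
component makes the image of `V` discrete. -/
def martinEmbedding (p : V → V → ℝ) (o y : V) : (V → ℝ) × (V → ℝ) :=
  (fun x => martinKernel p o x y, fun x => if x = y then 1 else 0)

/-- The Martin compactification: the smallest compactification of the discrete set `V` to which all
the functions `k_o(x, ·)` extend continuously, realised as the closure of the image of `V` in the
product space. -/
def martinCompactification (p : V → V → ℝ) (o : V) : Set ((V → ℝ) × (V → ℝ)) :=
  closure (Set.range (martinEmbedding p o))

/-- The Martin boundary: the points of the Martin compactification that are not in `V`. -/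
def martinBoundary (p : V → V → ℝ) (o : V) : Set ((V → ℝ) × (V → ℝ)) :=
  martinCompactification p o \ Set.range (martinEmbedding p o)

/-- The extension of `k_o(x, ·)` to the Martin compactification: it is continuous in `ξ` and takes
the value `k_o(x, y)` at the image of `y`. -/
def extMartinKernel (ξ : (V → ℝ) × (V → ℝ)) (x : V) : ℝ :=
  ξ.1 x

theorem extMartinKernel_martinEmbedding (p : V → V → ℝ) (o x y : V) :
    extMartinKernel (martinEmbedding p o y) x = martinKernel p o x y := rfl

theorem continuous_extMartinKernel (x : V) :
    Continuous fun ξ : (V → ℝ) × (V → ℝ) => extMartinKernel ξ x :=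
  (continuous_apply x).comp continuous_fst

/-- `P`-harmonic functions: `∑_y p(x, y) |f(y)| < ∞` and `∑_y p(x, y) f(y) = f(x)` for all `x`. -/
def IsHarmonic (p : V → V → ℝ) (f : V → ℝ) : Prop :=
  ∀ x, (Summable fun y => p x y * |f y|) ∧ ∑' y, p x y * f y = f x

/-- The integral of `h` with respect to a signed measure, by its Jordan decomposition. -/
def signedIntegral [MeasurableSpace V] (μ : SignedMeasure V) (h : V → ℝ) : ℝ :=
  (∫ x, h x ∂μ.toJordanDecomposition.posPart) - ∫ x, h x ∂μ.toJordanDecomposition.negPart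

/-- `L(h, μ)(x) = ∫ h dμ - μ(V) h(x)`. -/
def meanOp [MeasurableSpace V] (h : V → ℝ) (μ : SignedMeasure V) (x : V) : ℝ :=
  signedIntegral μ h - μ Set.univ * h x

/-- The mean value property of `μ` with respect to a family `𝓕` (of `|μ|`-integrable functions)
and the point `o`. -/
def HasMVP [MeasurableSpace V] (μ : SignedMeasure V) (𝓕 : Set (V → ℝ)) (o : V) : Prop :=
  ∀ h ∈ 𝓕, meanOp h μ o = 0

/-- The strong mean value property: the family consists of all `|μ|`-integrable harmonic functions. -/
def StrongMVP [MeasurableSpace V] (p : V → V → ℝ) (μ : SignedMeasure V) (o : V) : Prop :=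
  HasMVP μ {h | IsHarmonic p h ∧ Integrable h μ.totalVariation} o

/-- The weak mean value property: the family consists of all bounded harmonic functions. -/
def WeakMVP [MeasurableSpace V] (p : V → V → ℝ) (μ : SignedMeasure V) (o : V) : Prop :=
  HasMVP μ {h | IsHarmonic p h ∧ ∃ C : ℝ, ∀ x, |h x| ≤ C} o

/-- The signed measure `μ` has finite support: it vanishes on every set disjoint from some finite
set. -/
def HasFiniteSupport [MeasurableSpace V] (μ : SignedMeasure V) : Prop :=
  ∃ s : Finset V, ∀ A : Set V, MeasurableSet A → Disjoint A (s : Set V) → μ A = 0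

end MVPTree

end

open MeasureTheory

noncomputable section

namespace MVPTree

variable {V : Type*}

/-! Finite support makes every function `|μ|`-integrable, and `L(h, μ)(o)` depends linearly on the
values of `h` on a finite subtree `B` containing `o` and the support. It is therefore enough to
write each harmonic `h`, on `B` only, as a combination of harmonic Martin kernels.

Every function on `B` is a combination `∑ γ c * F(·, c)` with `c` in `B` (`exists_coeff`). Among
these functions only `F(·, b)` fails to be harmonic at `b`, and by transience it does fail there
(`tsum_mul_hitProb_self_lt_one`). Let `h` be harmonic and consider the branches of the tree that
leave `B` at `b`. If none contains a ray, `h` and the combination also agree at the neighbours of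
`b` (`eq_of_acc`), so `γ b = 0` (`coeff_eq_zero`). If one contains a ray, its end is a boundary
point whose kernel is harmonic and, off that branch, proportional to `F(·, b)`
(`exists_boundary_of_not_acc`). Both cases rest on the tree factorisation `F(x, y) = F(x, w) F(w,
y)` (`hitProb_eq_mul`).

This gives the third claim. In the locally finite case every boundary kernel is harmonic, which
gives the second. -/

/-- Harmonicity at a single vertex. -/
def HarmonicAt (p : V → V → ℝ) (f : V → ℝ) (x : V) : Prop :=
  (Summable fun y => p x y * |f y|) ∧ ∑' y, p x y * f y = f x

theorem HarmonicAt.summable {p : V → V → ℝ} (hp : IsMarkov p) {f : V → ℝ} {x : V}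
    (h : HarmonicAt p f x) : Summable fun y => p x y * f y := by
  refine Summable.of_norm ?_
  refine h.1.congr fun y => ?_
  rw [Real.norm_eq_abs, abs_mul, abs_of_nonneg (hp.nonneg x y)]

theorem harmonicAt_of_hasSum {p : V → V → ℝ} (hp : IsMarkov p) {f : V → ℝ} {x : V}
    (h : HasSum (fun y => p x y * f y) (f x)) : HarmonicAt p f x := by
  refine ⟨?_, h.tsum_eq⟩
  refine h.summable.abs.congr fun y => ?_
  rw [abs_mul, abs_of_nonneg (hp.nonneg x y)]

/-! ### Hitting probabilities and their minimality -/

theorem IsMarkov.summable_mul {p : V → V → ℝ} (hp : IsMarkov p) {f : V → ℝ}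
    (h0 : ∀ z, 0 ≤ f z) (h1 : ∀ z, f z ≤ 1) (x : V) : Summable fun z => p x z * f z :=
  Summable.of_nonneg_of_le (fun z => mul_nonneg (hp.nonneg x z) (h0 z))
    (fun z => mul_le_of_le_one_right (hp.nonneg x z) (h1 z)) (hp.row_sum x).summable

theorem IsMarkov.tsum_mul_mem {p : V → V → ℝ} (hp : IsMarkov p) {f : V → ℝ}
    (h0 : ∀ z, 0 ≤ f z) (h1 : ∀ z, f z ≤ 1) (x : V) :
    0 ≤ ∑' z, p x z * f z ∧ ∑' z, p x z * f z ≤ 1 := by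
  refine ⟨tsum_nonneg fun z => mul_nonneg (hp.nonneg x z) (h0 z), ?_⟩
  rw [← (hp.row_sum x).tsum_eq]
  exact (hp.summable_mul h0 h1 x).tsum_le_tsum
    (fun z => mul_le_of_le_one_right (hp.nonneg x z) (h1 z)) (hp.row_sum x).summable

theorem stepProb_mem {p : V → V → ℝ} (hp : IsMarkov p) (n : ℕ) (x y : V) :
    0 ≤ stepProb p n x y ∧ stepProb p n x y ≤ 1 := by
  induction n generalizing x with
  | zero => simp only [stepProb]; split_ifs <;> simp
  | succ n ih =>
    simp only [stepProb]
    exact hp.tsum_mul_mem (fun z => (ih z).1) (fun z => (ih z).2) x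

theorem firstHitProb_mem {p : V → V → ℝ} (hp : IsMarkov p) (n : ℕ) (x y : V) :
    0 ≤ firstHitProb p n x y ∧ firstHitProb p n x y ≤ 1 := by
  induction n generalizing x with
  | zero => simp only [firstHitProb]; split_ifs <;> simp
  | succ n ih =>
    simp only [firstHitProb]
    split_ifs
    · simp
    · exact hp.tsum_mul_mem (fun z => (ih z).1) (fun z => (ih z).2) x

/-- Off `y`, the probability of a hit within `n + 1` steps is the `p`-average of the probability of
a hit within `n` steps, so the bound by a superharmonic `g` propagates by induction. -/
theorem sum_firstHitProb_le {p : V → V → ℝ} (hp : IsMarkov p) {y : V} {g : V → ℝ}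
    (h0 : ∀ x, 0 ≤ g x) (h1 : 1 ≤ g y) (hs : ∀ x ≠ y, Summable fun z => p x z * g z)
    (hle : ∀ x ≠ y, ∑' z, p x z * g z ≤ g x) (n : ℕ) (x : V) :
    ∑ k ∈ Finset.range n, firstHitProb p k x y ≤ g x := by
  induction n generalizing x with
  | zero => simpa using h0 x
  | succ n ih =>
    rw [Finset.sum_range_succ']
    by_cases hxy : x = y
    · subst hxy
      simpa [firstHitProb] using h1
    · simp only [firstHitProb, if_neg hxy, add_zero]
      have hsum : ∀ k, Summable fun z => p x z * firstHitProb p k z y := fun k =>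
        hp.summable_mul (fun z => (firstHitProb_mem hp k z y).1)
          (fun z => (firstHitProb_mem hp k z y).2) x
      rw [← Summable.tsum_finsetSum fun k _ => hsum k]
      refine le_trans ((summable_sum fun k _ => hsum k).tsum_le_tsum (fun z => ?_) (hs x hxy))
        (hle x hxy)
      rw [← Finset.mul_sum]
      exact mul_le_mul_of_nonneg_left (ih z) (hp.nonneg x z)

theorem summable_firstHitProb {p : V → V → ℝ} (hp : IsMarkov p) (x y : V) :
    Summable fun n => firstHitProb p n x y := by
  refine summable_of_sum_range_le (c := 1) (fun n => (firstHitProb_mem hp n x y).1) fun n => ?_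
  refine sum_firstHitProb_le (g := fun _ => 1) hp (fun _ => zero_le_one) le_rfl (fun x _ => ?_)
    (fun x _ => ?_) n x
  · simpa using (hp.row_sum x).summable
  · simpa using (hp.row_sum x).tsum_eq.le

/-- `F(·, y)` is the smallest nonnegative function that is superharmonic off `y` and at least `1`
at `y`. -/
theorem hitProb_le {p : V → V → ℝ} (hp : IsMarkov p) {y : V} {g : V → ℝ}
    (h0 : ∀ x, 0 ≤ g x) (h1 : 1 ≤ g y) (hs : ∀ x ≠ y, Summable fun z => p x z * g z)
    (hle : ∀ x ≠ y, ∑' z, p x z * g z ≤ g x) (x : V) : hitProb p x y ≤ g x :=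
  Real.tsum_le_of_sum_range_le (fun n => (firstHitProb_mem hp n x y).1)
    fun n => sum_firstHitProb_le hp h0 h1 hs hle n x

theorem hitProb_nonneg {p : V → V → ℝ} (hp : IsMarkov p) (x y : V) : 0 ≤ hitProb p x y :=
  tsum_nonneg fun n => (firstHitProb_mem hp n x y).1

theorem hitProb_le_one {p : V → V → ℝ} (hp : IsMarkov p) (x y : V) : hitProb p x y ≤ 1 :=
  hitProb_le (g := fun _ => 1) hp (fun _ => zero_le_one) le_rfl
    (fun x _ => by simpa using (hp.row_sum x).summable)
    (fun x _ => by simpa using (hp.row_sum x).tsum_eq.le) x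

theorem hitProb_self (p : V → V → ℝ) (x : V) : hitProb p x x = 1 := by
  rw [hitProb, tsum_eq_single 0]
  · simp [firstHitProb]
  · intro n hn
    obtain ⟨m, rfl⟩ := Nat.exists_eq_succ_of_ne_zero hn
    simp [firstHitProb]

theorem summable_mul_hitProb {p : V → V → ℝ} (hp : IsMarkov p) (x y : V) :
    Summable fun z => p x z * hitProb p z y :=
  hp.summable_mul (fun z => hitProb_nonneg hp z y) (fun z => hitProb_le_one hp z y) x

/-- Decomposition by the first step; nonnegativity allows the two sums to be exchanged. -/
theorem tsum_mul_hitProb {p : V → V → ℝ} (hp : IsMarkov p) {x y : V} (hxy : x ≠ y) :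
    ∑' z, p x z * hitProb p z y = hitProb p x y := by
  have hprod : Summable fun q : V × ℕ => p x q.1 * firstHitProb p q.2 q.1 y := by
    have hnn : ∀ q : V × ℕ, 0 ≤ p x q.1 * firstHitProb p q.2 q.1 y := fun q =>
      mul_nonneg (hp.nonneg _ _) (firstHitProb_mem hp q.2 q.1 y).1
    refine (summable_prod_of_nonneg hnn).2 ?_
    refine ⟨fun z => Summable.mul_left (p x z) (summable_firstHitProb hp z y), ?_⟩
    simp only [tsum_mul_left]
    exact summable_mul_hitProb hp x y
  have hcomm := Summable.tsum_comm (f := fun (z : V) (n : ℕ) => p x z * firstHitProb p n z y) hprod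
  have hsucc : ∀ n, firstHitProb p (n + 1) x y = ∑' z, p x z * firstHitProb p n z y := fun n => by
    simp only [firstHitProb, if_neg hxy]
  have hzero : firstHitProb p 0 x y = 0 := by simp only [firstHitProb, if_neg hxy]
  have hF : hitProb p x y = ∑' n, ∑' z, p x z * firstHitProb p n z y := by
    rw [hitProb, (summable_firstHitProb hp x y).tsum_eq_zero_add, hzero, zero_add]
    exact tsum_congr hsucc
  rw [hF, hcomm]
  exact tsum_congr fun z => tsum_mul_left.symm

theorem harmonicAt_hitProb {p : V → V → ℝ} (hp : IsMarkov p) {x y : V} (hxy : x ≠ y) :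
    HarmonicAt p (fun z => hitProb p z y) x :=
  harmonicAt_of_hasSum hp <| by
    simpa only [tsum_mul_hitProb hp hxy] using (summable_mul_hitProb hp x y).hasSum

/-! ### Green function and transience -/

theorem hasSum_mul_green {p : V → V → ℝ} (hp : IsMarkov p) (htrans : IsTransient p) (x y : V) :
    HasSum (fun z => p x z * ∑' n, stepProb p n z y)
      ((∑' n, stepProb p n x y) - stepProb p 0 x y) := by
  have hprod : Summable fun q : ℕ × V => p x q.2 * stepProb p q.1 q.2 y := by
    rw [summable_prod_of_nonneg fun q =>
      mul_nonneg (hp.nonneg _ _) (stepProb_mem hp q.1 q.2 y).1]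
    refine ⟨fun n => hp.summable_mul (fun z => (stepProb_mem hp n z y).1)
      (fun z => (stepProb_mem hp n z y).2) x, ?_⟩
    exact (summable_nat_add_iff 1).2 (htrans x y)
  have hcomm := Summable.tsum_comm (f := fun (n : ℕ) (z : V) => p x z * stepProb p n z y) hprod
  have hs := hprod.prod_symm.prod
  simp only [Prod.swap, tsum_mul_left] at hs
  have hG : (∑' n, stepProb p n x y) - stepProb p 0 x y
      = ∑' z, p x z * ∑' n, stepProb p n z y := by
    rw [(htrans x y).tsum_eq_zero_add, add_sub_cancel_left]
    refine Eq.trans (tsum_congr fun n => rfl) (hcomm.symm.trans ?_)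
    exact tsum_congr fun z => tsum_mul_left
  rw [hG]
  exact hs.hasSum

/-- In the transient case the walk returns to its starting point with probability less than `1`. -/
theorem tsum_mul_hitProb_self_lt_one {p : V → V → ℝ} (hp : IsMarkov p) (htrans : IsTransient p)
    (x : V) : ∑' z, p x z * hitProb p z x < 1 := by
  set g : V → ℝ := fun z => ∑' n, stepProb p n z x with hg
  have hg0 : ∀ z, 0 ≤ g z := fun z => tsum_nonneg fun n => (stepProb_mem hp n z x).1
  have hgx : 1 ≤ g x := by
    have := (htrans x x).le_tsum 0 fun n _ => (stepProb_mem hp n x x).1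
    simpa [stepProb] using this
  have hpos : 0 < g x := lt_of_lt_of_le one_pos hgx
  -- `G(·, x) / G(x, x)` is harmonic off `x` and equals `1` at `x`, so it competes in the minimality
  -- of `F(·, x)`. Averaging at `x` then bounds the return probability by `(G(x, x) - 1) / G(x, x)`.
  have hle : ∀ z, hitProb p z x ≤ g z / g x := by
    refine hitProb_le hp (fun z => div_nonneg (hg0 z) hpos.le) (div_self hpos.ne').ge
      (fun y _ => ?_) (fun y hy => ?_)
    · simpa only [mul_div_assoc] using (hasSum_mul_green hp htrans y x).summable.div_const (g x)
    · have := ((hasSum_mul_green hp htrans y x).div_const (g x)).tsum_eq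
      simp only [mul_div_assoc] at this
      rw [this]
      simp [stepProb, hy, hg]
  have hsum := hasSum_mul_green hp htrans x x
  have h2 : ∑' z, p x z * hitProb p z x ≤ (g x - 1) / g x := by
    have h3 := hsum.div_const (g x)
    simp only [stepProb, if_true] at h3
    refine hasSum_le (fun z => ?_) (summable_mul_hitProb hp x x).hasSum h3
    rw [mul_div_assoc]
    exact mul_le_mul_of_nonneg_left (hle z) (hp.nonneg x z)
  refine lt_of_le_of_lt h2 ?_
  rw [div_lt_one hpos]
  linarith

/-! ### Positivity and factorisation through a separating vertex -/

theorem hitProb_pos {p : V → V → ℝ} (hp : IsMarkov p) {T : SimpleGraph V} (hT : T.Connected)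
    (hadapted : IsAdapted T p) (x y : V) : 0 < hitProb p x y := by
  obtain ⟨q⟩ := hT.preconnected x y
  induction q with
  | nil => rw [hitProb_self]; exact one_pos
  | @cons u v w huv q ih =>
    by_cases h : u = w
    · rw [h, hitProb_self]; exact one_pos
    · rw [← tsum_mul_hitProb hp h]
      exact lt_of_lt_of_le (mul_pos ((hadapted u v).2 huv) ih)
        ((summable_mul_hitProb hp u w).le_tsum v fun z _ =>
          mul_nonneg (hp.nonneg u z) (hitProb_nonneg hp z w))

theorem IsAdapted.eq_zero {p : V → V → ℝ} (hp : IsMarkov p) {T : SimpleGraph V}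
    (hadapted : IsAdapted T p) {x y : V} (h : ¬ T.Adj x y) : p x y = 0 :=
  le_antisymm (not_lt.1 fun h' => h ((hadapted x y).1 h')) (hp.nonneg x y)

theorem IsAdapted.mul_congr {p : V → V → ℝ} (hp : IsMarkov p) {T : SimpleGraph V}
    (hadapted : IsAdapted T p) {x : V} {f g : V → ℝ} (h : ∀ y, T.Adj x y → f y = g y) :
    (fun y => p x y * f y) = fun y => p x y * g y := by
  ext y
  by_cases hxy : T.Adj x y
  · rw [h y hxy]
  · rw [hadapted.eq_zero hp hxy, zero_mul, zero_mul]

theorem IsAdapted.harmonicAt_congr {p : V → V → ℝ} (hp : IsMarkov p) {T : SimpleGraph V}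
    (hadapted : IsAdapted T p) {x : V} {f g : V → ℝ} (h : ∀ y, T.Adj x y → f y = g y)
    (hx : f x = g x) (hf : HarmonicAt p f x) : HarmonicAt p g x := by
  refine harmonicAt_of_hasSum hp ?_
  rw [← hadapted.mul_congr hp h, ← hx, ← hf.2]
  exact (hf.summable hp).hasSum

/-- `F(x, y) = F(x, w) F(w, y)` when `w` separates `x` from `y`. -/
theorem hitProb_eq_mul {p : V → V → ℝ} (hp : IsMarkov p) {T : SimpleGraph V} (hT : T.Connected)
    (hadapted : IsAdapted T p) {C : Set V} {w y : V} (hw : w ∉ C) (hy : y ∉ C)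
    (hC : ∀ z ∈ C, ∀ z', T.Adj z z' → z' ∈ C ∨ z' = w) {x : V} (hx : x ∈ C) :
    hitProb p x y = hitProb p x w * hitProb p w y := by
  classical
  have hpos := hitProb_pos hp hT hadapted w y
  have key : ∀ z ∈ C, hitProb p z w * hitProb p w y ≤ hitProb p z y := by
    intro z hz
    -- Competitor for `F(·, w)`: both formulas equal `1` at `w`, the only gate of `C`, so the pasted
    -- function is harmonic off `w`.
    set g : V → ℝ := fun z => if z ∈ C then hitProb p z y / hitProb p w y else hitProb p z w with hg
    have hsuper : ∀ u ≠ w, HasSum (fun z => p u z * g z) (g u) := by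
      intro u hu
      by_cases huC : u ∈ C
      · have hcongr : (fun z => p u z * (hitProb p z y / hitProb p w y)) = fun z => p u z * g z := by
          refine hadapted.mul_congr hp fun v hv => ?_
          rcases hC u huC v hv with h | rfl
          · simp [hg, h]
          · simp [hg, hw, hitProb_self, hpos.ne']
        have hne : u ≠ y := fun h => hy (h ▸ huC)
        rw [← hcongr]
        have := (summable_mul_hitProb hp u y).hasSum.div_const (hitProb p w y)
        rw [tsum_mul_hitProb hp hne] at this
        simpa [hg, huC, mul_div_assoc] using this
      · have hcongr : (fun z => p u z * hitProb p z w) = fun z => p u z * g z := by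
          refine hadapted.mul_congr hp fun v hv => ?_
          have : v ∉ C := fun hv' => (hC v hv' u hv.symm).elim huC hu
          simp [hg, this]
        rw [← hcongr]
        have := (summable_mul_hitProb hp u w).hasSum
        rw [tsum_mul_hitProb hp hu] at this
        simpa [hg, huC] using this
    have := hitProb_le (g := g) hp (y := w) (fun z => ?_) ?_ (fun u hu => (hsuper u hu).summable)
      (fun u hu => (hsuper u hu).tsum_eq.le) z
    · simp only [hg, hz, if_true] at this
      rwa [le_div_iff₀ hpos] at this
    · simp only [hg]
      split_ifs
      · exact div_nonneg (hitProb_nonneg hp _ _) hpos.le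
      · exact hitProb_nonneg hp _ _
    · simp [hg, hw, hitProb_self]
  refine le_antisymm ?_ (key x hx)
  -- Competitor for `F(·, y)`. By `key` it lies below `F(·, y)`, with equality off `C`, which makes
  -- it superharmonic there; inside `C` it is a multiple of `F(·, w)`.
  set g : V → ℝ := fun z => if z ∈ C then hitProb p z w * hitProb p w y else hitProb p z y with hg
  have hg0 : ∀ z, 0 ≤ g z := fun z => by
    simp only [hg]
    split_ifs
    · exact mul_nonneg (hitProb_nonneg hp _ _) hpos.le
    · exact hitProb_nonneg hp _ _
  have hgle : ∀ z, g z ≤ hitProb p z y := fun z => by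
    simp only [hg]
    split_ifs with h
    · exact key z h
    · exact le_rfl
  have hsum : ∀ u, Summable fun z => p u z * g z := fun u =>
    hp.summable_mul hg0 (fun z => (hgle z).trans (hitProb_le_one hp z y)) u
  have := hitProb_le (g := g) hp (y := y) hg0 (by simp [hg, hy, hitProb_self])
    (fun u _ => hsum u) (fun u hu => ?_) x
  · simpa [hg, hx] using this
  · by_cases huC : u ∈ C
    · have hcongr : (fun z => p u z * (hitProb p z w * hitProb p w y)) = fun z => p u z * g z := by
        refine hadapted.mul_congr hp fun v hv => ?_
        rcases hC u huC v hv with h | rfl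
        · simp [hg, h]
        · simp [hg, hw, hitProb_self]
      rw [← hcongr]
      simp only [← mul_assoc]
      rw [tsum_mul_right, tsum_mul_hitProb hp (show u ≠ w from fun h => hw (h ▸ huC))]
      simp [hg, huC]
    · have : g u = hitProb p u y := by simp [hg, huC]
      rw [this, ← tsum_mul_hitProb hp hu]
      exact (hsum u).tsum_le_tsum (fun z => mul_le_mul_of_nonneg_left (hgle z) (hp.nonneg u z))
        (summable_mul_hitProb hp u y)

/-! ### Cones of a tree -/

/-- The vertices that the edge between `b` and `w` connects to `b` through `w`: the component of
`w` after this edge is deleted. -/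
def cone (T : SimpleGraph V) (b w : V) : Set V :=
  {z | (T.deleteEdges {s(b, w)}).Reachable w z}

theorem self_mem_cone (T : SimpleGraph V) (b w : V) : w ∈ cone T b w :=
  SimpleGraph.Reachable.refl _

theorem notMem_cone {T : SimpleGraph V} (hT : T.IsAcyclic) {b w : V} (hbw : T.Adj b w) :
    b ∉ cone T b w := fun h =>
  SimpleGraph.isBridge_iff.1 (SimpleGraph.isAcyclic_iff_forall_adj_isBridge.1 hT hbw) h.symm

theorem mem_cone_or_eq_of_adj {T : SimpleGraph V} (hT : T.IsAcyclic) {b w z z' : V}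
    (hbw : T.Adj b w) (hz : z ∈ cone T b w) (h : T.Adj z z') :
    z' ∈ cone T b w ∨ (z = w ∧ z' = b) := by
  by_cases he : s(z, z') = s(b, w)
  · rw [Sym2.eq_iff] at he
    rcases he with ⟨rfl, rfl⟩ | ⟨rfl, rfl⟩
    · exact absurd hz (notMem_cone hT hbw)
    · exact Or.inr ⟨rfl, rfl⟩
  · left
    have : (T.deleteEdges {s(b, w)}).Adj z z' := by
      rw [SimpleGraph.deleteEdges_adj]
      exact ⟨h, he⟩
    exact SimpleGraph.Reachable.trans hz this.reachable

/-- A walk from `v` avoiding the edge `wv` could leave the larger cone only from `w`, but `w` is not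
in the cone of `v`. -/
theorem cone_subset_cone {T : SimpleGraph V} (hT : T.IsAcyclic) {b w v : V}
    (hbw : T.Adj b w) (hwv : T.Adj w v) (hv : v ≠ b) : cone T w v ⊆ cone T b w := by
  rintro z ⟨q⟩
  have hstart : v ∈ cone T b w :=
    (mem_cone_or_eq_of_adj hT hbw (self_mem_cone T b w) hwv).resolve_right fun h => hv h.2
  have key : ∀ {u z : V}, (T.deleteEdges {s(w, v)}).Walk u z → u ∈ cone T w v → u ∈ cone T b w →
      z ∈ cone T b w := by
    intro u z q
    induction q with
    | nil => exact fun _ h => h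
    | cons huv q ih =>
      intro hu hu'
      refine ih (SimpleGraph.Reachable.trans hu huv.reachable) ?_
      refine (mem_cone_or_eq_of_adj hT hbw hu' (SimpleGraph.deleteEdges_le _ huv)).resolve_right ?_
      rintro ⟨rfl, -⟩
      exact notMem_cone hT hwv hu
  exact key q (self_mem_cone T w v) hstart

theorem hitProb_eq_mul_of_mem_cone {p : V → V → ℝ} (hp : IsMarkov p) {T : SimpleGraph V}
    (hT : T.IsTree) (hadapted : IsAdapted T p) {b w x y : V} (hbw : T.Adj b w)
    (hx : x ∈ cone T b w) (hy : y ∉ cone T b w) :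
    hitProb p x y = hitProb p x b * hitProb p b y :=
  hitProb_eq_mul hp hT.1 hadapted (notMem_cone hT.2 hbw) hy
    (fun _ hz _ h => (mem_cone_or_eq_of_adj hT.2 hbw hz h).imp_right And.right) hx

theorem hitProb_eq_mul_of_notMem_cone {p : V → V → ℝ} (hp : IsMarkov p) {T : SimpleGraph V}
    (hT : T.IsTree) (hadapted : IsAdapted T p) {b w x y : V} (hbw : T.Adj b w)
    (hx : x ∉ cone T b w) (hy : y ∈ cone T b w) :
    hitProb p x y = hitProb p x b * hitProb p b y := by
  by_cases hxb : x = b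
  · rw [hxb, hitProb_self, one_mul]
  -- The complement of the cone, with `b` removed, is also left only through `b`.
  refine hitProb_eq_mul (C := {z | z ∉ cone T b w ∧ z ≠ b}) hp hT.1 hadapted (fun h => h.2 rfl)
    (fun h => h.1 hy) ?_ ⟨hx, hxb⟩
  rintro z ⟨hz, hzb⟩ z' h
  refine or_iff_not_imp_right.2 fun hz' => ⟨fun hmem => ?_, hz'⟩
  rcases mem_cone_or_eq_of_adj hT.2 hbw hmem h.symm with h1 | h1
  · exact hz h1
  · exact hzb h1.2

/-! ### Cones without rays, and ends of rays -/

/-- The edge `e` follows the edge `d` without backtracking. -/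
def Follows (T : SimpleGraph V) (e d : V × V) : Prop :=
  e.1 = d.2 ∧ T.Adj e.1 e.2 ∧ e.2 ≠ d.1

/-- On a cone without rays, harmonic functions are constant. -/
theorem eq_of_acc {p : V → V → ℝ} (hp : IsMarkov p) {T : SimpleGraph V}
    (hT : T.IsAcyclic) (hadapted : IsAdapted T p) {d : V × V} (hacc : Acc (Follows T) d)
    (hd : T.Adj d.1 d.2) {h : V → ℝ} (hh : ∀ z ∈ cone T d.1 d.2, HarmonicAt p h z) :
    h d.2 = h d.1 := by
  classical
  induction hacc with
  | intro d _ ih =>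
    obtain ⟨b, w⟩ := d
    simp only at hd hh ⊢
    have hch : ∀ v, T.Adj w v → v ≠ b → h v = h w := fun v hv hvb =>
      ih (w, v) ⟨rfl, hv, hvb⟩ hv fun z hz => hh z (cone_subset_cone hT hd hv hvb hz)
    have hw := hh w (self_mem_cone T b w)
    -- The mean value equation at `w`, written in differences, retains only the term of the parent
    -- `b`, since by induction `h` equals `h w` at all other neighbours.
    have h1 : HasSum (fun y => p w y * (h y - h w)) (h w - 1 * h w) := by
      have := (hw.summable hp).hasSum
      rw [hw.2] at this
      simpa only [mul_sub] using this.sub ((hp.row_sum w).mul_right (h w))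
    have h2 : HasSum (fun y => p w y * (h y - h w)) (p w b * (h b - h w)) := by
      refine hasSum_single b fun y hy => ?_
      by_cases hwy : T.Adj w y
      · rw [hch y hwy hy, sub_self, mul_zero]
      · rw [hadapted.eq_zero hp hwy, zero_mul]
    have h3 := h1.unique h2
    rw [one_mul, sub_self, eq_comm, mul_eq_zero] at h3
    rcases h3 with h3 | h3
    · exact absurd h3 ((hadapted w b).2 hd.symm).ne'
    · linarith

/-- If there are rays in the cone of `w`, then one of their ends provides a boundary point with
harmonic kernel, proportional to `F(·, b)` off the cone. -/
theorem exists_boundary_of_not_acc {p : V → V → ℝ} (hp : IsMarkov p) {T : SimpleGraph V}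
    (hT : T.IsTree) (hadapted : IsAdapted T p) {o b w : V} (hbw : T.Adj b w)
    (ho : o ∉ cone T b w) (hacc : ¬ Acc (Follows T) (b, w)) :
    ∃ ξ ∈ martinBoundary p o, IsHarmonic p (extMartinKernel ξ) ∧
      ∀ z ∉ cone T b w, extMartinKernel ξ z = martinKernel p o z b := by
  classical
  obtain ⟨e, he0, he⟩ := not_acc_iff_exists_descending_chain.1 hacc
  have hadj : ∀ n, T.Adj (e n).1 (e n).2 := fun n => by
    cases n with
    | zero => rw [he0]; exact hbw
    | succ n => exact (he n).2.1
  set x : ℕ → V := fun n => (e n).1 with hx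
  have he2 : ∀ n, (e n).2 = x (n + 1) := fun n => (he n).1.symm
  have hx0 : x 0 = b := by simp [hx, he0]
  have hx1 : x 1 = w := by rw [← he2, he0]
  have hxadj : ∀ n, T.Adj (x n) (x (n + 1)) := fun n => he2 n ▸ hadj n
  have hne : ∀ n, x (n + 2) ≠ x n := fun n => he2 (n + 1) ▸ (he n).2.2
  set C : ℕ → Set V := fun n => cone T (x n) (x (n + 1)) with hC
  have hC0 : C 0 = cone T b w := by simp only [hC, hx0, zero_add, hx1]
  have hanti : Antitone C := antitone_nat_of_succ_le fun n =>
    cone_subset_cone hT.2 (hxadj n) (hxadj (n + 1)) (hne n)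
  have hxC : ∀ n, x n ∉ C n := fun n => notMem_cone hT.2 (hxadj n)
  have hxC' : ∀ m n, m < n → x n ∈ C m := fun m n hmn => by
    obtain ⟨k, rfl⟩ := Nat.exists_eq_add_of_lt hmn
    exact hanti (Nat.le_add_right m k) (self_mem_cone T _ _)
  have hinj : Function.Injective x := fun m n h => by
    rcases lt_trichotomy m n with hmn | hmn | hmn
    · exact absurd (h ▸ hxC' m n hmn) (hxC m)
    · exact hmn
    · exact absurd (h ▸ hxC' n m hmn) (hxC n)
  -- If `z` lay in every cone, one finite walk from `z` to `x 0` would have to pass through each of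
  -- the infinitely many `x n`.
  have hexit : ∀ z, ∃ n, z ∉ C n := by
    intro z
    by_contra! hz
    obtain ⟨q⟩ := hT.1.preconnected z (x 0)
    have hmem : ∀ n, ∀ {u v : V} (q : T.Walk u v), u ∈ C n → v ∉ C n → x n ∈ q.support := by
      intro n u v q
      induction q with
      | nil => exact fun h1 h2 => absurd h1 h2
      | @cons u v' v huv q ih =>
        intro hu hv
        rw [SimpleGraph.Walk.support_cons]
        rcases mem_cone_or_eq_of_adj hT.2 (hxadj n) hu huv with h | h
        · exact List.mem_cons_of_mem _ (ih h hv)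
        · rw [← h.2]
          exact List.mem_cons_of_mem _ q.start_mem_support
    refine Set.infinite_range_of_injective hinj (q.support.toFinset.finite_toSet.subset ?_)
    rintro _ ⟨n, rfl⟩
    have : x 0 ∉ C n := fun h => hxC 0 (hanti (Nat.zero_le n) h)
    simpa using hmem n q (hz n) this
  have hF := hitProb_pos hp hT.1 hadapted
  -- Both `z` and `o` reach `x m` through `x n`, so `F(x n, x m)` cancels and the kernels stabilise
  -- along the ray.
  have hker : ∀ n m, n ≤ m → ∀ z ∉ C n, martinKernel p o z (x m) = martinKernel p o z (x n) := by
    intro n m hnm z hz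
    rcases hnm.eq_or_lt with rfl | hnm
    · rfl
    have hon : o ∉ C n := fun h => ho (hC0 ▸ hanti (Nat.zero_le n) h)
    rw [martinKernel, martinKernel,
      hitProb_eq_mul_of_notMem_cone hp hT hadapted (hxadj n) hz (hxC' n m hnm),
      hitProb_eq_mul_of_notMem_cone hp hT hadapted (hxadj n) hon (hxC' n m hnm)]
    exact mul_div_mul_right _ _ (hF _ _).ne'
  choose N hN using hexit
  set k : V → ℝ := fun z => martinKernel p o z (x (N z)) with hk
  have hkn : ∀ n, ∀ z ∉ C n, k z = martinKernel p o z (x n) := by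
    intro n z hz
    rcases le_total n (N z) with h | h
    · exact hker n (N z) h z hz
    · exact (hker (N z) n h z (hN z)).symm
  -- The second coordinate is the limit of the indicators of `x n`. Being `0`, it separates the
  -- limit from every vertex.
  refine ⟨(k, 0), ⟨?_, ?_⟩, ?_, ?_⟩
  · refine mem_closure_of_tendsto (f := fun n => martinEmbedding p o (x n)) (b := Filter.atTop) ?_
      (Filter.Eventually.of_forall fun n => Set.mem_range_self _)
    refine Filter.Tendsto.prodMk_nhds (tendsto_pi_nhds.2 fun z => ?_)
      (tendsto_pi_nhds.2 fun z => ?_)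
    · refine tendsto_const_nhds.congr' ?_
      filter_upwards [Filter.eventually_ge_atTop (N z)] with n hn
      exact (hker (N z) n hn z (hN z)).symm
    · refine tendsto_const_nhds.congr' ?_
      filter_upwards [Filter.eventually_gt_atTop (N z)] with n hn
      have : z ≠ x n := fun h => hN z (h ▸ hxC' (N z) n hn)
      simp [this]
  · rintro ⟨y, hy⟩
    have := congrFun (congrArg Prod.snd hy) y
    simp [martinEmbedding] at this
  · intro z
    -- One step beyond `N z` ensures `z ≠ x n`. Then the neighbours of `z` are also outside `C n`,
    -- and near `z` the limit is `k_o(·, x n)`, harmonic at `z`.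
    set n := N z + 1 with hn
    have hzn : z ∉ C n := fun h => hN z (hanti (Nat.le_succ _) h)
    have hzx : z ≠ x n := fun h => hN z (h ▸ hxC' (N z) n (Nat.lt_succ_self _))
    have hharm : HarmonicAt p (fun y => martinKernel p o y (x n)) z := by
      have := harmonicAt_hitProb hp hzx
      refine harmonicAt_of_hasSum hp ?_
      have h2 := (this.summable hp).hasSum.div_const (hitProb p o (x n))
      rw [this.2] at h2
      simpa only [mul_div_assoc, martinKernel] using h2
    refine hadapted.harmonicAt_congr hp (fun y hy => (hkn n y fun h => ?_).symm)
      (hkn n z hzn).symm hharm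
    rcases mem_cone_or_eq_of_adj hT.2 (hxadj n) h hy.symm with h1 | h1
    · exact hzn h1
    · exact hzx h1.2
  · intro z hz
    rw [← hx0]
    exact hkn 0 z (hC0 ▸ hz)

/-- A walk inside `B` from a point of the cone to `b` would have to leave the cone from `w`, which
is not in `B`. -/
theorem disjoint_cone_of_induce_connected {T : SimpleGraph V} (hT : T.IsAcyclic) {B : Set V}
    (hB : (T.induce B).Preconnected) {b w : V} (hb : b ∈ B) (hw : w ∉ B) (hbw : T.Adj b w) :
    ∀ c ∈ B, c ∉ cone T b w := by
  intro c hc hcone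
  obtain ⟨q⟩ := hB ⟨c, hc⟩ ⟨b, hb⟩
  have key : ∀ {u v : B}, (T.induce B).Walk u v → (u : V) ∈ cone T b w → (v : V) ∈ cone T b w := by
    intro u v q
    induction q with
    | nil => exact id
    | @cons u v' v huv q ih =>
      intro hu
      refine ih ((mem_cone_or_eq_of_adj hT hbw hu (by simpa using huv)).resolve_right fun h => ?_)
      exact hw (h.1 ▸ u.2)
  exact notMem_cone hT hbw (key q hcone)

/-! ### Interpolation on a finite subtree -/

section Hull

variable {p : V → V → ℝ} {T : SimpleGraph V} {B : Finset V}

theorem sum_mul_hitProb_eq_of_adj (hp : IsMarkov p) (hT : T.IsTree)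
    (hadapted : IsAdapted T p) (hB : (T.induce (B : Set V)).Preconnected) (γ : V → ℝ) {b w : V}
    (hb : b ∈ B) (hw : w ∉ B) (hbw : T.Adj b w) :
    ∑ c ∈ B, γ c * hitProb p w c = hitProb p w b * ∑ c ∈ B, γ c * hitProb p b c := by
  rw [Finset.mul_sum]
  refine Finset.sum_congr rfl fun c hc => ?_
  rw [hitProb_eq_mul_of_mem_cone hp hT hadapted hbw (self_mem_cone T b w)
    (disjoint_cone_of_induce_connected hT.2 hB hb hw hbw c hc)]
  ring

/-- Only the term `c = b` is not harmonic at `b`; its defect is the probability of no return to `b`.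
-/
theorem hasSum_mul_sum_hitProb (hp : IsMarkov p) (γ : V → ℝ) {b : V} (hb : b ∈ B) :
    HasSum (fun z => p b z * ∑ c ∈ B, γ c * hitProb p z c)
      ((∑ c ∈ B, γ c * hitProb p b c) - γ b * (1 - ∑' z, p b z * hitProb p z b)) := by
  classical
  have h := hasSum_sum (s := B) fun c _ => (summable_mul_hitProb hp b c).hasSum.mul_left (γ c)
  have heq : (fun z => p b z * ∑ c ∈ B, γ c * hitProb p z c)
      = fun z => ∑ c ∈ B, γ c * (p b z * hitProb p z c) := by
    ext z
    rw [Finset.mul_sum]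
    exact Finset.sum_congr rfl fun c _ => by ring
  rw [heq]
  have hval : (∑ c ∈ B, γ c * hitProb p b c) - γ b * (1 - ∑' z, p b z * hitProb p z b)
      = ∑ c ∈ B, γ c * ∑' z, p b z * hitProb p z c := by
    rw [← Finset.add_sum_erase B _ hb, ← Finset.add_sum_erase B _ hb, hitProb_self,
      Finset.sum_congr rfl fun c hc =>
        congrArg (γ c * ·) (tsum_mul_hitProb hp (Finset.ne_of_mem_erase hc).symm)]
    ring
  rw [hval]
  exact h

/-- If a combination of the functions `F(·, c)` agrees, at `b` and at the neighbours of `b`, with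
a function that is harmonic at `b`, its coefficient at `b` is zero. -/
theorem coeff_eq_zero (hp : IsMarkov p) (htrans : IsTransient p) (hadapted : IsAdapted T p)
    (γ : V → ℝ) {b : V} (hb : b ∈ B) {h : V → ℝ} (hh : HarmonicAt p h b)
    (hhb : ∑ c ∈ B, γ c * hitProb p b c = h b)
    (hnbr : ∀ w, T.Adj b w → ∑ c ∈ B, γ c * hitProb p w c = h w) : γ b = 0 := by
  have h1 := hasSum_mul_sum_hitProb hp γ hb
  rw [hadapted.mul_congr hp hnbr, hhb] at h1
  have h2 := h1.tsum_eq
  rw [hh.2] at h2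
  have h3 : γ b * (1 - ∑' z, p b z * hitProb p z b) = 0 := by linarith
  refine (mul_eq_zero.1 h3).resolve_right ?_
  have := tsum_mul_hitProb_self_lt_one hp htrans b
  linarith

/-- On a finite subtree every function is a combination of the functions `F(·, c)`. -/
theorem exists_coeff (hp : IsMarkov p) (htrans : IsTransient p) (hT : T.IsTree)
    (hadapted : IsAdapted T p) (hB : (T.induce (B : Set V)).Preconnected) (h : V → ℝ) :
    ∃ γ : V → ℝ, ∀ b ∈ B, ∑ c ∈ B, γ c * hitProb p b c = h b := by
  classical
  let A : Matrix B B ℝ := Matrix.of fun b c => hitProb p b c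
  have hA : ∀ γ : V → ℝ, ∀ b : B, A.mulVecLin (fun c => γ c) b
      = ∑ c ∈ B, γ c * hitProb p b c := by
    intro γ b
    rw [Matrix.mulVecLin_apply, Matrix.mulVec, dotProduct,
      ← Finset.sum_coe_sort B fun c => γ c * hitProb p b c]
    exact Finset.sum_congr rfl fun c _ => mul_comm _ _
  have hext : ∀ v : B → ℝ, (fun c : B => (fun x : V => if hx : x ∈ B then v ⟨x, hx⟩ else 0) c) = v :=
    fun v => by ext c; simp
  -- A combination that vanishes on `B` also vanishes at all neighbours of `B`, hence agrees locally
  -- with the harmonic function `0` and has zero coefficients.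
  have hinj : Function.Injective A.mulVecLin := by
    refine (injective_iff_map_eq_zero _).2 fun v hv => ?_
    set γ : V → ℝ := fun x => if hx : x ∈ B then v ⟨x, hx⟩ else 0
    have h0 : ∀ b ∈ B, ∑ c ∈ B, γ c * hitProb p b c = 0 := fun b hb => by
      rw [← hA γ ⟨b, hb⟩, hext v, hv]
      rfl
    rw [← hext v]
    ext c
    refine coeff_eq_zero (h := fun _ => 0) hp htrans hadapted γ c.2
      (harmonicAt_of_hasSum hp (by simp [hasSum_zero])) (h0 c c.2) fun w hw => ?_
    by_cases hwB : w ∈ B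
    · exact h0 w hwB
    · rw [sum_mul_hitProb_eq_of_adj hp hT hadapted hB γ c.2 hwB hw, h0 c c.2, mul_zero]
  obtain ⟨v, hv⟩ := LinearMap.injective_iff_surjective.1 hinj fun b : B => h b
  refine ⟨fun x => if hx : x ∈ B then v ⟨x, hx⟩ else 0, fun b hb => ?_⟩
  rw [← hA _ ⟨b, hb⟩, hext v, hv]

/-- On a finite subtree containing `o`, every harmonic function is a combination of the functions
`F(·, b)` that are there proportional to a harmonic Martin kernel. -/
theorem exists_coeff_of_isHarmonic (hp : IsMarkov p) (htrans : IsTransient p) (hT : T.IsTree)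
    (hadapted : IsAdapted T p) (hB : (T.induce (B : Set V)).Preconnected) {o : V} (ho : o ∈ B)
    {h : V → ℝ} (hh : IsHarmonic p h) :
    ∃ γ : V → ℝ, (∀ x ∈ B, h x = ∑ b ∈ B, γ b * hitProb p x b) ∧
      ∀ b ∈ B, γ b ≠ 0 → ∃ ξ ∈ martinBoundary p o, IsHarmonic p (extMartinKernel ξ) ∧
        ∀ x ∈ B, extMartinKernel ξ x = martinKernel p o x b := by
  obtain ⟨γ, hγ⟩ := exists_coeff hp htrans hT hadapted hB h
  refine ⟨γ, fun x hx => (hγ x hx).symm, fun b hb hne => ?_⟩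
  by_cases hacc : ∀ w ∉ B, T.Adj b w → Acc (Follows T) (b, w)
  · refine absurd (coeff_eq_zero hp htrans hadapted γ hb (hh b) (hγ b hb) fun w hw => ?_) hne
    by_cases hwB : w ∈ B
    · exact hγ w hwB
    · have h1 : hitProb p w b = hitProb p b b :=
        eq_of_acc (h := fun z => hitProb p z b) hp hT.2 hadapted (hacc w hwB hw) hw fun z hz =>
          harmonicAt_hitProb hp fun hzb => notMem_cone hT.2 hw (hzb ▸ hz)
      have h2 : h w = h b := eq_of_acc hp hT.2 hadapted (hacc w hwB hw) hw fun z _ => hh z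
      rw [sum_mul_hitProb_eq_of_adj hp hT hadapted hB γ hb hwB hw, hγ b hb, h1, h2, hitProb_self,
        one_mul]
  · push Not at hacc
    obtain ⟨w, hwB, hw, hacc⟩ := hacc
    have hdisj := disjoint_cone_of_induce_connected hT.2 hB hb hwB hw
    obtain ⟨ξ, hξ, hharm, hker⟩ :=
      exists_boundary_of_not_acc hp hT hadapted hw (hdisj o ho) hacc
    exact ⟨ξ, hξ, hharm, fun x hx => hker x (hdisj x hx)⟩

end Hull

/-! ### Finitely supported signed measures -/

section Measure

variable [MeasurableSpace V] [DiscreteMeasurableSpace V]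

/-- The Jordan parts are, up to sign, restrictions of `μ` to the two halves of a Hahn decomposition,
so no mass off the support is hidden by cancellation. -/
theorem HasFiniteSupport.exists_null {μ : SignedMeasure V} (hμ : HasFiniteSupport μ) :
    ∃ s : Finset V, μ.toJordanDecomposition.posPart (s : Set V)ᶜ = 0 ∧
      μ.toJordanDecomposition.negPart (s : Set V)ᶜ = 0 := by
  obtain ⟨s, hs⟩ := hμ
  obtain ⟨i, hi₁, hi₂, hi₃, hpos, hneg⟩ := μ.toJordanDecomposition_spec
  have hzero : ∀ j : Set V, μ (j ∩ (s : Set V)ᶜ) = 0 := fun j =>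
    hs _ (.of_discrete) (Set.disjoint_left.2 fun x hx => hx.2)
  refine ⟨s, ?_, ?_⟩
  · rw [hpos, SignedMeasure.toMeasureOfZeroLE_apply _ _ hi₁ (.of_discrete)]
    simp [hzero]
  · rw [hneg, SignedMeasure.toMeasureOfLEZero_apply _ _ hi₁.compl (.of_discrete)]
    simp [hzero]

theorem integrable_of_null_compl {ν : Measure V} [IsFiniteMeasure ν] {s : Finset V}
    (hs : ν (s : Set V)ᶜ = 0) (h : V → ℝ) : Integrable h ν := by
  rw [← Measure.restrict_eq_self_of_ae_mem (s := (s : Set V)) (μ := ν) hs]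
  exact IntegrableOn.finset

theorem integral_of_null_compl {ν : Measure V} [IsFiniteMeasure ν] {s : Finset V}
    (hs : ν (s : Set V)ᶜ = 0) (h : V → ℝ) : ∫ x, h x ∂ν = ∑ x ∈ s, ν.real {x} * h x := by
  have h1 := setIntegral_finset (μ := ν) (f := h) s IntegrableOn.finset
  rwa [Measure.restrict_eq_self_of_ae_mem (s := (s : Set V)) (μ := ν) hs] at h1

theorem HasFiniteSupport.exists_signedIntegral_eq {μ : SignedMeasure V} (hμ : HasFiniteSupport μ) :
    ∃ (s : Finset V) (a : V → ℝ), ∀ h, signedIntegral μ h = ∑ x ∈ s, a x * h x := by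
  obtain ⟨s, hpos, hneg⟩ := hμ.exists_null
  refine ⟨s, fun x => μ.toJordanDecomposition.posPart.real {x}
    - μ.toJordanDecomposition.negPart.real {x}, fun h => ?_⟩
  rw [signedIntegral, integral_of_null_compl hpos, integral_of_null_compl hneg,
    ← Finset.sum_sub_distrib]
  exact Finset.sum_congr rfl fun x _ => (sub_mul _ _ _).symm

theorem HasFiniteSupport.integrable {μ : SignedMeasure V} (hμ : HasFiniteSupport μ) (h : V → ℝ) :
    Integrable h μ.totalVariation := by
  obtain ⟨s, hpos, hneg⟩ := hμ.exists_null
  exact integrable_of_null_compl (s := s) (by simp [SignedMeasure.totalVariation, hpos, hneg]) h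

theorem strongMVP_iff {p : V → V → ℝ} {μ : SignedMeasure V} (hμ : HasFiniteSupport μ) {o : V} :
    StrongMVP p μ o ↔ ∀ h, IsHarmonic p h → meanOp h μ o = 0 :=
  ⟨fun H h hh => H h ⟨hh, hμ.integrable h⟩, fun H h hh => H h hh.1⟩

theorem meanOp_eq_zero {p : V → V → ℝ} (hp : IsMarkov p) {T : SimpleGraph V} (hT : T.IsTree)
    (hadapted : IsAdapted T p) (htrans : IsTransient p) {o : V} {μ : SignedMeasure V}
    (hμ : HasFiniteSupport μ)
    (H : ∀ ξ ∈ martinBoundary p o, IsHarmonic p (extMartinKernel ξ) →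
      meanOp (extMartinKernel ξ) μ o = 0) {h : V → ℝ} (hh : IsHarmonic p h) :
    meanOp h μ o = 0 := by
  classical
  obtain ⟨s, a, hs⟩ := hμ.exists_signedIntegral_eq
  obtain ⟨B, hsB, hB⟩ := SimpleGraph.extend_finset_to_connected hT.1.preconnected
    (Finset.insert_nonempty o s)
  have ho : o ∈ B := hsB (Finset.mem_insert_self o s)
  have hs' : ∀ x ∈ s, x ∈ B := fun x hx => hsB (Finset.mem_insert_of_mem hx)
  obtain ⟨γ, hγ, hker⟩ := exists_coeff_of_isHarmonic hp htrans hT hadapted hB.preconnected ho hh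
  have hF : ∀ b ∈ B, γ b ≠ 0 → meanOp (fun x => hitProb p x b) μ o = 0 := by
    intro b hb hne
    obtain ⟨ξ, hξ, hharm, hξb⟩ := hker b hb hne
    have hpos := hitProb_pos hp hT.1 hadapted o b
    have hmul : ∀ x ∈ B, hitProb p x b = hitProb p o b * extMartinKernel ξ x := fun x hx => by
      rw [hξb x hx, martinKernel, mul_div_cancel₀ _ hpos.ne']
    have := H ξ hξ hharm
    rw [meanOp, hs] at this ⊢
    rw [hmul o ho, Finset.sum_congr rfl fun x hx => congrArg (a x * ·) (hmul x (hs' x hx))]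
    have h2 : ∑ x ∈ s, a x * (hitProb p o b * extMartinKernel ξ x)
        = hitProb p o b * ∑ x ∈ s, a x * extMartinKernel ξ x := by
      rw [Finset.mul_sum]
      exact Finset.sum_congr rfl fun x _ => by ring
    rw [h2]
    linear_combination hitProb p o b * this
  have hlin : meanOp h μ o = ∑ b ∈ B, γ b * meanOp (fun x => hitProb p x b) μ o := by
    simp only [meanOp, hs]
    rw [hγ o ho, Finset.sum_congr rfl fun x hx => congrArg (a x * ·) (hγ x (hs' x hx))]
    simp only [mul_sub, Finset.sum_sub_distrib, Finset.mul_sum]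
    rw [Finset.sum_comm]
    congr 1 <;> refine Finset.sum_congr rfl fun b _ => ?_
    · exact Finset.sum_congr rfl fun x _ => by ring
    · ring
  rw [hlin]
  refine Finset.sum_eq_zero fun b hb => ?_
  by_cases hne : γ b = 0
  · rw [hne, zero_mul]
  · rw [hF b hb hne, mul_zero]

end Measure

/-- If the tree is locally finite, all the Martin kernels are harmonic. -/
theorem isHarmonic_extMartinKernel {p : V → V → ℝ} (hp : IsMarkov p) {T : SimpleGraph V}
    (hadapted : IsAdapted T p) (hfin : ∀ x, (T.neighborSet x).Finite) {o : V}
    {ξ : (V → ℝ) × (V → ℝ)} (hξ : ξ ∈ martinBoundary p o) :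
    IsHarmonic p (extMartinKernel ξ) := by
  intro x
  have hsum : ∀ f : V → ℝ, HasSum (fun y => p x y * f y)
      (∑ y ∈ (hfin x).toFinset, p x y * f y) := fun f =>
    hasSum_sum_of_ne_finset_zero fun y hy => by
      rw [hadapted.eq_zero hp (by simpa using hy), zero_mul]
  -- A boundary point is still a limit of vertices other than `x`. Their kernels satisfy the mean
  -- value equation at `x`, a closed condition because the sum is finite.
  have hmem : ξ ∈ closure (martinEmbedding p o '' {x}ᶜ) := by
    have h1 := hξ.1
    rw [martinCompactification, ← Set.image_univ, ← Set.union_compl_self {x}, Set.image_union,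
      closure_union, Set.image_singleton, closure_singleton] at h1
    exact h1.resolve_left fun h => hξ.2 ⟨x, h.symm⟩
  have hclosed : IsClosed {η : (V → ℝ) × (V → ℝ) |
      ∑ y ∈ (hfin x).toFinset, p x y * extMartinKernel η y = extMartinKernel η x} :=
    isClosed_eq (continuous_finsetSum _ fun y _ =>
      continuous_const.mul (continuous_extMartinKernel y)) (continuous_extMartinKernel x)
  refine harmonicAt_of_hasSum hp ?_
  have hsub : martinEmbedding p o '' {x}ᶜ ⊆ {η : (V → ℝ) × (V → ℝ) |
      ∑ y ∈ (hfin x).toFinset, p x y * extMartinKernel η y = extMartinKernel η x} := by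
    rintro _ ⟨y, hy, rfl⟩
    have hxy : x ≠ y := fun h => hy h.symm
    have h1 := (summable_mul_hitProb hp x y).hasSum.div_const (hitProb p o y)
    rw [tsum_mul_hitProb hp hxy] at h1
    simp only [mul_div_assoc] at h1
    exact (hsum fun z => martinKernel p o z y).unique h1
  have := closure_minimal hsub hclosed hmem
  exact this ▸ hsum (extMartinKernel ξ)

end MVPTree

end

theorem mainTheorem1 {V : Type*} [Countable V] [MeasurableSpace V] [DiscreteMeasurableSpace V]
    (T : SimpleGraph V) (hT : T.IsTree) (p : V → V → ℝ) (hp : MVPTree.IsMarkov p)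
    (hadapted : MVPTree.IsAdapted T p) (hirr : MVPTree.IsIrreducible p)
    (htrans : MVPTree.IsTransient p) (o : V)
    (μ : MeasureTheory.SignedMeasure V) (hμ : MVPTree.HasFiniteSupport μ) :
    (MVPTree.StrongMVP p μ o → MVPTree.WeakMVP p μ o) ∧
    ((∀ x, (T.neighborSet x).Finite) →
      (MVPTree.StrongMVP p μ o ↔
        ∀ ξ ∈ MVPTree.martinBoundary p o,
          MVPTree.meanOp (MVPTree.extMartinKernel ξ) μ o = 0)) ∧
    (MVPTree.StrongMVP p μ o ↔
      ∀ ξ ∈ MVPTree.martinBoundary p o,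
        MVPTree.IsHarmonic p (MVPTree.extMartinKernel ξ) →
          MVPTree.meanOp (MVPTree.extMartinKernel ξ) μ o = 0) := by
  have h3 : MVPTree.StrongMVP p μ o ↔ ∀ ξ ∈ MVPTree.martinBoundary p o,
      MVPTree.IsHarmonic p (MVPTree.extMartinKernel ξ) →
        MVPTree.meanOp (MVPTree.extMartinKernel ξ) μ o = 0 := by
    rw [MVPTree.strongMVP_iff hμ]
    exact ⟨fun H ξ _ hharm => H _ hharm, fun H h hh =>
      MVPTree.meanOp_eq_zero hp hT hadapted htrans hμ H hh⟩
  refine ⟨fun H h hh => (MVPTree.strongMVP_iff hμ).1 H h hh.1, fun hfin => ?_, h3⟩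
  rw [h3]
  exact ⟨fun H ξ hξ => H ξ hξ (MVPTree.isHarmonic_extMartinKernel hp hadapted hfin hξ),
    fun H ξ hξ _ => H ξ hξ⟩
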